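/- **Setting.** In the half-strip $\{(r,z): 0\le r\le 1,\ z\ge 0\}$ consider three curves $\Gamma_i(t)=\{(r_i,z_i)(\alpha,t):\alpha\in[0,1]\}$, $i=1,2,3$, with tangent angles $\theta_i(\alpha,t)\in(-\pi,\pi]$, which are smooth, free of self-intersections, and parametrized by normalized arc length: $r_{i\alpha}r_{i\alpha\alpha}+z_{i\alpha}z_{i\alpha\alpha}=0$; $\theta_i$ is continuous and $(\cos\theta_i,\sin\theta_i)=\hat\tau_i=(r_{i\alpha},z_{i\alpha})/\sqrt{r_{i\alpha}^2+z_{i\alpha}^2}$. Put $$H_i=\frac{r_{i\alpha}z_{i\alpha\alpha}-z_{i\alpha}r_{i\alpha\alpha}}{2(r_{i\alpha}^2+z_{i\alpha}^2)^{3/2}}+\frac{z_{i\alpha}}{2r_i\sqrt{r_{i\alpha}^2+z_{i\alpha}^2}} .$$ Given $\mathcal A,\mathcal B>0$, $\beta\in(\frac\pi2,\pi)$ and $\theta_c\in(0,\pi]$, the evolution problem is: for $\alpha\in(0,1)$, $t>0$, $$r_{i\alpha}z_{it}-z_{i\alpha}r_{it}=\frac{-\mathcal B\,(r_iH_{i\alpha})_\alpha}{r_i\sqrt{r_{i\alpha}^2+z_{i\alpha}^2}}\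 (i=1,2),\qquad r_{3\alpha}z_{3t}-z_{3\alpha}r_{3t}=\mathcal A\sqrt{r_{3\alpha}^2+z_{3\alpha}^2}\,H_3,$$ and for all $t\ge0$: $(r_1,z_1)(0)=(r_1^*,0)$, $(r_3,z_3)(0)=(r_3^*,0)$, $(r_2,z_2)(1)=(1,z_2^*)$, $(r_1,z_1)(1)=(r_2,z_2)(0)=(r_3,z_3)(1)=(\bar r,\bar z)$ with $0<r_1^*<r_3^*<1$, $z_2^*>0$, $0<\bar r<1$, $\bar z>0$; $\theta_1(0)=\theta_c$, $\theta_2(1)=0$, $\theta_3(0)=\frac\pi2$, $\theta_3(1)-\theta_1(1)=\beta$, $\theta_2(0)-\theta_3(1)=\beta-\pi$; $H_1(1)=H_2(0)$, $H_{1\alpha}(0)=0=H_{2\alpha}(1)$, $\frac{H_{1\alpha}}{\sqrt{r_{1\alpha}^2+z_{1\alpha}^2}}\big|_{\alpha=1}=\frac{H_{2\alpha}}{\sqrt{r_{2\alpha}^2+z_{2\alpha}^2}}\big|_{\alpha=0}$; $0<r_1,r_3<1$ on $[0,1]$, $0<r_2<1$ on $[0,1)$, $z_1,z_3>0$ on $(0,1]$,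 $z_2>0$ on $[0,1]$; and any two of the curves meet only at $(\bar r,\bar z)$. A *steady state for $(\beta,\theta_c)$* is a time-independent solution of this problem. **Parameters.** For $0<A<1$, $0<\sigma<\sqrt{1-A^2}$, $\beta\in(\frac\pi2,\pi)$ put $$\bar r=\sqrt{\sigma^2+A^2},\quad \bar z=A\,\mathrm{arcosh}(\bar r/A),\quad \bar\theta_3=\arcsin(A/\bar r),\quad \bar\theta_1=\bar\theta_3-\beta,\quad \bar\theta_2=\bar\theta_3-\pi+\beta,$$ $$\lambda=\frac{A\cos\beta+\sigma\sin\beta}{1-A^2-\sigma^2},\qquad a_\ell=\sqrt{\frac{(2A^2+2\sigma^2-1)A\cos\beta+\sigma\sin\beta}{A\cos\beta+\sigma\sin\beta}},$$ and consider the curves, as functions of an angle $\theta$, $$r_1(\theta)=\frac{\sin\theta-\sqrt{\sin^2\theta+4\lambda^2a_\ell^2}}{2\lambda},\quad z_1(\theta)=\bar z-\frac1{2\lambda}\int_{\bar\theta_1}^{\theta}\Bigl(\frac{\sin^2x}{\sqrt{\sin^2x+4\lambda^2a_\ell^2}}-\sin x\Bigr)dx,\quad\theta\in[\bar\theta_1,\theta_c],$$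 $$r_2(\theta)=\frac{\sin\theta-\sqrt{\sin^2\theta+4\lambda^2}}{2\lambda},\quad z_2(\theta)=\bar z-\frac1{2\lambda}\int_{\bar\theta_2}^{\theta}\Bigl(\frac{\sin^2x}{\sqrt{\sin^2x+4\lambda^2}}-\sin x\Bigr)dx,\quad\theta\in[0,\bar\theta_2],$$ $$r_3(\theta)=\frac{A}{\sin\theta},\quad z_3(\theta)=A\log\frac{1+\cos\theta}{\sin\theta},\quad\theta\in[\bar\theta_3,\tfrac\pi2].\tag{$*$}$$ The admissible region $\Lambda$ is the set of all $(A,\sigma,\beta)$ with $0<A<1$, $0<\sigma<\sqrt{1-A^2}$, $\beta\in(\frac\pi2,\pi)$ such that $$\tan\beta>\tfrac A\sigma(1-2A^2-2\sigma^2),\qquad \cos\beta<-\tfrac1{2A}\ \text{ if }\ \cos\beta<-\tfrac{A}{\sqrt{\sigma^2+A^2}},\qquad z_1(\pi)\le0,\qquad \tan\beta<\frac{A(1-A^2-2\sigma^2)}{\sigma(1-A^2)} .$$ A steady state is *given by $(*)$* if each $\Gamma_i$ is the $i$-th curve in $(*)$ with $\theta$ its own tangent angle $\theta_i(\alpha)$,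 which decreases strictly in $\alpha$ and ranges over the whole indicated interval, and if $\sigma$ is the arc length of $\Gamma_3$. **Theorem.** Let $\mathcal A,\mathcal B>0$ and $(A,\sigma,\beta)\in\Lambda$. 1. For every $\theta_c\in(0,\pi]$ with $z_1(\theta_c)=0$ there is a steady state for $(\beta,\theta_c)$ given by $(*)$. 2. There is exactly one $\theta_c\in(0,\pi]$ with $z_1(\theta_c)=0$. Moreover there is exactly one $\theta_c\in(0,\pi]$ for which there is a steady state for $(\beta,\theta_c)$ given by $(*)$. -/

import Mathlib

open Set Real
open scoped ContDiff

noncomputable section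

/-! ### The evolution problem in the meridian half-strip -/

/-- The time interval `[0, T)`, with `T = ⊤` allowed. -/
def timeInterval (T : EReal) : Set ℝ := {t : ℝ | 0 ≤ t ∧ (t : EReal) < T}

/-- Derivative with respect to the curve parameter `α ∈ [0, 1]` (one-sided at the end points). -/
def dAlpha (f : ℝ → ℝ → ℝ) : ℝ → ℝ → ℝ :=
  fun α t => derivWithin (fun a => f a t) (Icc 0 1) α

/-- Derivative with respect to time. -/
def dTime (f : ℝ → ℝ → ℝ) : ℝ → ℝ → ℝ :=
  fun α t => deriv (fun s => f α s) t

/-- An evolving profile curve `α ↦ (r (α, t), z (α, t))`, `α ∈ [0, 1]`, together with its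
tangent angle `θ (α, t)`. Arguments are in the order `α`, `t`. -/
structure EvolvingCurve where
  r : ℝ → ℝ → ℝ
  z : ℝ → ℝ → ℝ
  θ : ℝ → ℝ → ℝ

namespace EvolvingCurve

/-- The speed `√(r_α² + z_α²)`. -/
def speed (Γ : EvolvingCurve) (α t : ℝ) : ℝ :=
  √(dAlpha Γ.r α t ^ 2 + dAlpha Γ.z α t ^ 2)

/-- The radial component of the unit tangent. -/
def tauR (Γ : EvolvingCurve) (α t : ℝ) : ℝ := dAlpha Γ.r α t / Γ.speed α t

/-- The vertical component of the unit tangent. -/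
def tauZ (Γ : EvolvingCurve) (α t : ℝ) : ℝ := dAlpha Γ.z α t / Γ.speed α t

/-- The mean curvature (average of the principal curvatures) of the surface of revolution
generated by the curve. -/
def H (Γ : EvolvingCurve) (α t : ℝ) : ℝ :=
  (dAlpha Γ.r α t * dAlpha (dAlpha Γ.z) α t - dAlpha Γ.z α t * dAlpha (dAlpha Γ.r) α t) /
      (2 * (dAlpha Γ.r α t ^ 2 + dAlpha Γ.z α t ^ 2) ^ (3 / 2 : ℝ)) +
    dAlpha Γ.z α t / (2 * Γ.r α t * Γ.speed α t)

/-- The trace of the curve at time `t`. -/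
def trace (Γ : EvolvingCurve) (t : ℝ) : Set (ℝ × ℝ) :=
  (fun α => (Γ.r α t, Γ.z α t)) '' Icc 0 1

/-- The requirements made on each of the three curves separately: smoothness, normalized
arc-length parametrization, tangent angle in `(-π, π]`, and no self-intersection. -/
structure IsRegular (Γ : EvolvingCurve) (T : EReal) : Prop where
  contDiffOn_r : ContDiffOn ℝ ∞ (fun p : ℝ × ℝ => Γ.r p.1 p.2) (Icc 0 1 ×ˢ timeInterval T)
  contDiffOn_z : ContDiffOn ℝ ∞ (fun p : ℝ × ℝ => Γ.z p.1 p.2) (Icc 0 1 ×ˢ timeInterval T)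
  continuousOn_θ : ContinuousOn (fun p : ℝ × ℝ => Γ.θ p.1 p.2) (Icc 0 1 ×ˢ timeInterval T)
  equidistributed : ∀ α ∈ Icc (0 : ℝ) 1, ∀ t ∈ timeInterval T,
    dAlpha Γ.r α t * dAlpha (dAlpha Γ.r) α t + dAlpha Γ.z α t * dAlpha (dAlpha Γ.z) α t = 0
  cos_θ : ∀ α ∈ Icc (0 : ℝ) 1, ∀ t ∈ timeInterval T, cos (Γ.θ α t) = Γ.tauR α t
  sin_θ : ∀ α ∈ Icc (0 : ℝ) 1, ∀ t ∈ timeInterval T, sin (Γ.θ α t) = Γ.tauZ α t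
  θ_mem : ∀ α ∈ Icc (0 : ℝ) 1, ∀ t ∈ timeInterval T, Γ.θ α t ∈ Ioc (-π) π
  injOn : ∀ t ∈ timeInterval T, InjOn (fun α => (Γ.r α t, Γ.z α t)) (Icc 0 1)

/-- Motion by surface diffusion with Mullins' coefficient `ℬ`. -/
def SurfaceDiffusion (ℬ : ℝ) (T : EReal) (Γ : EvolvingCurve) : Prop :=
  ∀ α ∈ Ioo (0 : ℝ) 1, ∀ t ∈ timeInterval T, 0 < t →
    dAlpha Γ.r α t * dTime Γ.z α t - dAlpha Γ.z α t * dTime Γ.r α t =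
      -ℬ * dAlpha (fun a s => Γ.r a s * dAlpha Γ.H a s) α t / (Γ.r α t * Γ.speed α t)

/-- Motion by mean curvature with reduced mobility `𝒜`. -/
def MeanCurvatureMotion (𝒜 : ℝ) (T : EReal) (Γ : EvolvingCurve) : Prop :=
  ∀ α ∈ Ioo (0 : ℝ) 1, ∀ t ∈ timeInterval T, 0 < t →
    dAlpha Γ.r α t * dTime Γ.z α t - dAlpha Γ.z α t * dTime Γ.r α t =
      𝒜 * Γ.speed α t * Γ.H α t

end EvolvingCurve

/-- The axi-symmetric two-grain problem on `[0, T)`: `Γ₁`, `Γ₂` are the inner and the outer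
exterior surface, `Γ₃` is the grain boundary, the substrate is `z = 0` and the inert cylinder
is `r = 1`. The triple junction `(r̄, z̄)` is `(r₁, z₁)(1) = (r₂, z₂)(0) = (r₃, z₃)(1)`, and
`r₁* = r₁(0)`, `r₃* = r₃(0)`, `z₂* = z₂(1)`. -/
structure IsTwoGrainEvolution (𝒜 ℬ β θc : ℝ) (T : EReal) (Γ₁ Γ₂ Γ₃ : EvolvingCurve) :
    Prop where
  regular₁ : Γ₁.IsRegular T
  regular₂ : Γ₂.IsRegular T
  regular₃ : Γ₃.IsRegular T
  -- equations of motion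
  motion₁ : Γ₁.SurfaceDiffusion ℬ T
  motion₂ : Γ₂.SurfaceDiffusion ℬ T
  motion₃ : Γ₃.MeanCurvatureMotion 𝒜 T
  -- end points of the curves
  z₁_zero : ∀ t ∈ timeInterval T, Γ₁.z 0 t = 0
  z₃_zero : ∀ t ∈ timeInterval T, Γ₃.z 0 t = 0
  r₂_one : ∀ t ∈ timeInterval T, Γ₂.r 1 t = 1
  junction₁₂ : ∀ t ∈ timeInterval T, Γ₁.r 1 t = Γ₂.r 0 t ∧ Γ₁.z 1 t = Γ₂.z 0 t
  junction₁₃ : ∀ t ∈ timeInterval T, Γ₁.r 1 t = Γ₃.r 1 t ∧ Γ₁.z 1 t = Γ₃.z 1 t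
  endpoints : ∀ t ∈ timeInterval T, 0 < Γ₁.r 0 t ∧ Γ₁.r 0 t < Γ₃.r 0 t ∧ Γ₃.r 0 t < 1 ∧
    0 < Γ₂.z 1 t ∧ 0 < Γ₃.r 1 t ∧ Γ₃.r 1 t < 1 ∧ 0 < Γ₃.z 1 t
  -- balance of mechanical forces
  contact₁ : ∀ t ∈ timeInterval T, Γ₁.tauR 0 t = cos θc ∧ Γ₁.θ 0 t = θc
  contact₂ : ∀ t ∈ timeInterval T, Γ₂.tauZ 1 t = 0 ∧ Γ₂.θ 1 t = 0
  contact₃ : ∀ t ∈ timeInterval T, Γ₃.tauR 0 t = 0 ∧ Γ₃.θ 0 t = π / 2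
  herring₁ : ∀ t ∈ timeInterval T,
    Γ₁.tauR 1 t * Γ₃.tauR 1 t + Γ₁.tauZ 1 t * Γ₃.tauZ 1 t = cos β ∧
      -Γ₁.θ 1 t + Γ₃.θ 1 t = β
  herring₂ : ∀ t ∈ timeInterval T,
    -(Γ₂.tauR 0 t * Γ₃.tauR 1 t + Γ₂.tauZ 0 t * Γ₃.tauZ 1 t) = cos β ∧
      Γ₂.θ 0 t - Γ₃.θ 1 t = -π + β
  -- continuity of the chemical potential and balance of the mass flux
  potential : ∀ t ∈ timeInterval T, Γ₁.H 1 t = Γ₂.H 0 t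
  flux₁ : ∀ t ∈ timeInterval T, dAlpha Γ₁.H 0 t = 0
  flux₁₂ : ∀ t ∈ timeInterval T,
    dAlpha Γ₁.H 1 t / Γ₁.speed 1 t = dAlpha Γ₂.H 0 t / Γ₂.speed 0 t
  flux₂ : ∀ t ∈ timeInterval T, dAlpha Γ₂.H 1 t = 0
  -- persistence of the hole, of the exterior surfaces and of the grain boundary
  r₁_mem : ∀ α ∈ Icc (0 : ℝ) 1, ∀ t ∈ timeInterval T, Γ₁.r α t ∈ Ioo 0 1
  r₃_mem : ∀ α ∈ Icc (0 : ℝ) 1, ∀ t ∈ timeInterval T, Γ₃.r α t ∈ Ioo 0 1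
  r₂_mem : ∀ α ∈ Ico (0 : ℝ) 1, ∀ t ∈ timeInterval T, Γ₂.r α t ∈ Ioo 0 1
  z₁_pos : ∀ α ∈ Ioc (0 : ℝ) 1, ∀ t ∈ timeInterval T, 0 < Γ₁.z α t
  z₃_pos : ∀ α ∈ Ioc (0 : ℝ) 1, ∀ t ∈ timeInterval T, 0 < Γ₃.z α t
  z₂_pos : ∀ α ∈ Icc (0 : ℝ) 1, ∀ t ∈ timeInterval T, 0 < Γ₂.z α t
  -- the curves meet only at the triple junction
  inter₁₂ : ∀ t ∈ timeInterval T, Γ₁.trace t ∩ Γ₂.trace t = {(Γ₃.r 1 t, Γ₃.z 1 t)}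
  inter₁₃ : ∀ t ∈ timeInterval T, Γ₁.trace t ∩ Γ₃.trace t = {(Γ₃.r 1 t, Γ₃.z 1 t)}
  inter₂₃ : ∀ t ∈ timeInterval T, Γ₂.trace t ∩ Γ₃.trace t = {(Γ₃.r 1 t, Γ₃.z 1 t)}

/-! ### Steady states -/

/-- A time-independent profile curve with its tangent angle. -/
structure ProfileCurve where
  r : ℝ → ℝ
  z : ℝ → ℝ
  θ : ℝ → ℝ

/-- A profile curve regarded as an evolving curve that does not move. -/
def ProfileCurve.stationary (Γ : ProfileCurve) : EvolvingCurve where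
  r := fun α _ => Γ.r α
  z := fun α _ => Γ.z α
  θ := fun α _ => Γ.θ α

/-- A steady state: a time-independent solution, on `[0, ∞)`, of the two-grain problem. -/
def IsSteadyState (𝒜 ℬ β θc : ℝ) (Γ₁ Γ₂ Γ₃ : ProfileCurve) : Prop :=
  IsTwoGrainEvolution 𝒜 ℬ β θc ⊤ Γ₁.stationary Γ₂.stationary Γ₃.stationary

/-! ### The explicit expressions in terms of `A`, `σ`, `β` -/

def rBar (A σ : ℝ) : ℝ := √(σ ^ 2 + A ^ 2)

def zBar (A σ : ℝ) : ℝ := A * arcosh (rBar A σ / A)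

def thetaBar₃ (A σ : ℝ) : ℝ := arcsin (A / rBar A σ)

def thetaBar₁ (A σ β : ℝ) : ℝ := thetaBar₃ A σ - β

def thetaBar₂ (A σ β : ℝ) : ℝ := thetaBar₃ A σ - π + β

/-- The common mean curvature `λ` of the exterior surfaces. -/
def lam (A σ β : ℝ) : ℝ := (A * cos β + σ * sin β) / (1 - A ^ 2 - σ ^ 2)

def aEll (A σ β : ℝ) : ℝ :=
  √(((2 * A ^ 2 + 2 * σ ^ 2 - 1) * A * cos β + σ * sin β) / (A * cos β + σ * sin β))

/-- Radial coordinate of a nodary with mean curvature `l`, as a function of the tangent angle. -/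
def nodaryR (l a θ : ℝ) : ℝ :=
  (sin θ - √(sin θ ^ 2 + 4 * l ^ 2 * a ^ 2)) / (2 * l)

/-- Height of the nodary that is at height `z₀` for the tangent angle `θ₀`. -/
def nodaryZ (l a θ₀ z₀ θ : ℝ) : ℝ :=
  -1 / (2 * l) * (∫ x in θ₀..θ, (sin x ^ 2 / √(sin x ^ 2 + 4 * l ^ 2 * a ^ 2) - sin x)) + z₀

def r₁Fun (A σ β θ : ℝ) : ℝ := nodaryR (lam A σ β) (aEll A σ β) θ

def z₁Fun (A σ β θ : ℝ) : ℝ :=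
  nodaryZ (lam A σ β) (aEll A σ β) (thetaBar₁ A σ β) (zBar A σ) θ

def r₂Fun (A σ β θ : ℝ) : ℝ := nodaryR (lam A σ β) 1 θ

def z₂Fun (A σ β θ : ℝ) : ℝ := nodaryZ (lam A σ β) 1 (thetaBar₂ A σ β) (zBar A σ) θ

def r₃Fun (A θ : ℝ) : ℝ := A / sin θ

def z₃Fun (A θ : ℝ) : ℝ := A * log ((1 + cos θ) / sin θ)

/-- The profile curve is `(R, Z)` expressed in terms of its own tangent angle, which decreases
strictly along the curve and ranges over `[lo, hi]`. -/
structure ProfileCurve.IsGivenByAngle (Γ : ProfileCurve) (R Z : ℝ → ℝ) (lo hi : ℝ) : Prop where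
  strictAntiOn : StrictAntiOn Γ.θ (Icc 0 1)
  image_eq : Γ.θ '' Icc 0 1 = Icc lo hi
  r_eq : ∀ α ∈ Icc (0 : ℝ) 1, Γ.r α = R (Γ.θ α)
  z_eq : ∀ α ∈ Icc (0 : ℝ) 1, Γ.z α = Z (Γ.θ α)

/-- The three curves are the ones prescribed by `(A, σ, β, θc)`: they are given by the explicit
expressions in the angle variables, and `σ` is the arc length of `Γ₃`. -/
structure IsPrescribedBy (A σ β θc : ℝ) (Γ₁ Γ₂ Γ₃ : ProfileCurve) : Prop where
  curve₁ : Γ₁.IsGivenByAngle (r₁Fun A σ β) (z₁Fun A σ β) (thetaBar₁ A σ β) θc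
  curve₂ : Γ₂.IsGivenByAngle (r₂Fun A σ β) (z₂Fun A σ β) 0 (thetaBar₂ A σ β)
  curve₃ : Γ₃.IsGivenByAngle (r₃Fun A) (z₃Fun A) (thetaBar₃ A σ) (π / 2)
  length₃ : ∫ α in (0 : ℝ)..1, Γ₃.stationary.speed α 0 = σ

/-- The admissible region `Λ` of parameters `(A, σ, β)`. -/
def admissibleRegion : Set (ℝ × ℝ × ℝ) :=
  {p | ∃ A σ β : ℝ, p = (A, σ, β) ∧
    A ∈ Ioo 0 1 ∧ σ ∈ Ioo 0 (√(1 - A ^ 2)) ∧ β ∈ Ioo (π / 2) π ∧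
    tan β > A / σ * (1 - 2 * A ^ 2 - 2 * σ ^ 2) ∧
    (cos β < -(A / √(σ ^ 2 + A ^ 2)) → cos β < -(1 / (2 * A))) ∧
    z₁Fun A σ β π ≤ 0 ∧
    tan β < A * (1 - A ^ 2 - 2 * σ ^ 2) / (σ * (1 - A ^ 2))}

end

/-! ### Curves parametrized proportionally to arc length -/

/-- The curve has constant speed `L`, tangent angle `θ` and signed curvature `κ`. -/
structure ProfileCurve.HasConstantSpeed (Γ : ProfileCurve) (L : ℝ) (κ : ℝ → ℝ) : Prop where
  pos : 0 < L
  hasDerivAt_r : ∀ α, HasDerivAt Γ.r (L * cos (Γ.θ α)) α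
  hasDerivAt_z : ∀ α, HasDerivAt Γ.z (L * sin (Γ.θ α)) α
  hasDerivAt_θ : ∀ α, HasDerivAt Γ.θ (L * κ α) α
  contDiff_θ : ContDiff ℝ ∞ Γ.θ

theorem derivWithin_unitInterval_eq {f g : ℝ → ℝ} {f' α : ℝ} (hα : α ∈ Icc (0 : ℝ) 1)
    (hfg : ∀ x ∈ Icc (0 : ℝ) 1, f x = g x) (hg : HasDerivAt g f' α) :
    derivWithin f (Icc 0 1) α = f' := by
  rw [derivWithin_congr hfg (hfg α hα)]
  exact hg.hasDerivWithinAt.derivWithin (uniqueDiffOn_Icc zero_lt_one α hα)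

namespace ProfileCurve.HasConstantSpeed

variable {Γ : ProfileCurve} {L : ℝ} {κ : ℝ → ℝ} (hΓ : Γ.HasConstantSpeed L κ)

include hΓ

theorem contDiff_r : ContDiff ℝ ∞ Γ.r := by
  rw [contDiff_infty_iff_deriv]
  refine ⟨fun α => (hΓ.hasDerivAt_r α).differentiableAt, ?_⟩
  rw [show deriv Γ.r = fun α => L * cos (Γ.θ α) from funext fun α => (hΓ.hasDerivAt_r α).deriv]
  exact contDiff_const.mul (contDiff_cos.comp hΓ.contDiff_θ)

theorem contDiff_z : ContDiff ℝ ∞ Γ.z := by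
  rw [contDiff_infty_iff_deriv]
  refine ⟨fun α => (hΓ.hasDerivAt_z α).differentiableAt, ?_⟩
  rw [show deriv Γ.z = fun α => L * sin (Γ.θ α) from funext fun α => (hΓ.hasDerivAt_z α).deriv]
  exact contDiff_const.mul (contDiff_sin.comp hΓ.contDiff_θ)

variable {α : ℝ} (hα : α ∈ Icc (0 : ℝ) 1) (t : ℝ)

include hα

theorem dAlpha_r : dAlpha Γ.stationary.r α t = L * cos (Γ.θ α) :=
  derivWithin_unitInterval_eq hα (fun _ _ => rfl) (hΓ.hasDerivAt_r α)

theorem dAlpha_z : dAlpha Γ.stationary.z α t = L * sin (Γ.θ α) :=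
  derivWithin_unitInterval_eq hα (fun _ _ => rfl) (hΓ.hasDerivAt_z α)

theorem dAlpha_dAlpha_r :
    dAlpha (dAlpha Γ.stationary.r) α t = L * (-sin (Γ.θ α) * (L * κ α)) :=
  derivWithin_unitInterval_eq hα (fun _ hx => hΓ.dAlpha_r hx t)
    ((hΓ.hasDerivAt_θ α).cos.const_mul L)

theorem dAlpha_dAlpha_z :
    dAlpha (dAlpha Γ.stationary.z) α t = L * (cos (Γ.θ α) * (L * κ α)) :=
  derivWithin_unitInterval_eq hα (fun _ hx => hΓ.dAlpha_z hx t)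
    ((hΓ.hasDerivAt_θ α).sin.const_mul L)

theorem sq_add_sq :
    dAlpha Γ.stationary.r α t ^ 2 + dAlpha Γ.stationary.z α t ^ 2 = L ^ 2 := by
  rw [hΓ.dAlpha_r hα, hΓ.dAlpha_z hα]
  linear_combination L ^ 2 * sin_sq_add_cos_sq (Γ.θ α)

theorem speed_eq : Γ.stationary.speed α t = L := by
  rw [EvolvingCurve.speed, hΓ.sq_add_sq hα, sqrt_sq hΓ.pos.le]

theorem tauR_eq : Γ.stationary.tauR α t = cos (Γ.θ α) := by
  rw [EvolvingCurve.tauR, hΓ.speed_eq hα, hΓ.dAlpha_r hα, mul_div_cancel_left₀ _ hΓ.pos.ne']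

theorem tauZ_eq : Γ.stationary.tauZ α t = sin (Γ.θ α) := by
  rw [EvolvingCurve.tauZ, hΓ.speed_eq hα, hΓ.dAlpha_z hα, mul_div_cancel_left₀ _ hΓ.pos.ne']

theorem H_eq : Γ.stationary.H α t = (κ α + sin (Γ.θ α) / Γ.r α) / 2 := by
  have hL := hΓ.pos
  have hpow : (L ^ 2) ^ (3 / 2 : ℝ) = L ^ 3 := by
    rw [← rpow_natCast, ← rpow_mul hL.le, ← rpow_natCast]; norm_num
  rw [EvolvingCurve.H, hΓ.sq_add_sq hα, hpow, hΓ.speed_eq hα, hΓ.dAlpha_r hα, hΓ.dAlpha_z hα,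
    hΓ.dAlpha_dAlpha_r hα, hΓ.dAlpha_dAlpha_z hα]
  have h1 : (L * cos (Γ.θ α) * (L * (cos (Γ.θ α) * (L * κ α))) -
      L * sin (Γ.θ α) * (L * (-sin (Γ.θ α) * (L * κ α)))) / (2 * L ^ 3) = κ α / 2 := by
    rw [div_eq_div_iff (by positivity) two_ne_zero]
    linear_combination 2 * L ^ 3 * κ α * sin_sq_add_cos_sq (Γ.θ α)
  have h2 : L * sin (Γ.θ α) / (2 * Γ.stationary.r α t * L) = sin (Γ.θ α) / Γ.r α / 2 := by
    rw [mul_comm L, mul_div_mul_right _ _ hL.ne', div_div, mul_comm 2]; rfl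
  rw [h1, h2, add_div]

omit hα

theorem isRegular (T : EReal) (hmem : ∀ α ∈ Icc (0 : ℝ) 1, Γ.θ α ∈ Ioc (-π) π)
    (hinj : InjOn (fun α => (Γ.r α, Γ.z α)) (Icc 0 1)) : Γ.stationary.IsRegular T where
  contDiffOn_r := (hΓ.contDiff_r.comp contDiff_fst).contDiffOn
  contDiffOn_z := (hΓ.contDiff_z.comp contDiff_fst).contDiffOn
  continuousOn_θ := (hΓ.contDiff_θ.continuous.comp continuous_fst).continuousOn
  equidistributed α hα t _ := by
    rw [hΓ.dAlpha_r hα, hΓ.dAlpha_z hα, hΓ.dAlpha_dAlpha_r hα, hΓ.dAlpha_dAlpha_z hα]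
    ring
  cos_θ α hα t _ := (hΓ.tauR_eq hα t).symm
  sin_θ α hα t _ := (hΓ.tauZ_eq hα t).symm
  θ_mem α hα _ _ := hmem α hα
  injOn _ _ := hinj

variable {h : ℝ} (hH : ∀ α ∈ Icc (0 : ℝ) 1, κ α + sin (Γ.θ α) / Γ.r α = 2 * h)

include hH

theorem H_eq_const (hα : α ∈ Icc (0 : ℝ) 1) : Γ.stationary.H α t = h := by
  rw [hΓ.H_eq hα, hH α hα]; ring

theorem dAlpha_H (hα : α ∈ Icc (0 : ℝ) 1) : dAlpha Γ.stationary.H α t = 0 :=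
  derivWithin_unitInterval_eq hα (fun _ hx => hΓ.H_eq_const t hH hx) (hasDerivAt_const α h)

theorem surfaceDiffusion (ℬ : ℝ) (T : EReal) : Γ.stationary.SurfaceDiffusion ℬ T := by
  intro α hα t _ _
  have hflux : dAlpha (fun a s => Γ.stationary.r a s * dAlpha Γ.stationary.H a s) α t = 0 :=
    derivWithin_unitInterval_eq (Ioo_subset_Icc_self hα)
      (fun x hx => mul_eq_zero_of_right _ (hΓ.dAlpha_H t hH hx)) (hasDerivAt_const α 0)
  rw [hflux]
  simp [dTime, ProfileCurve.stationary]

omit h hH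

theorem meanCurvatureMotion (hH : ∀ α ∈ Icc (0 : ℝ) 1, κ α + sin (Γ.θ α) / Γ.r α = 0)
    (𝒜 : ℝ) (T : EReal) : Γ.stationary.MeanCurvatureMotion 𝒜 T := by
  intro α hα t _ _
  rw [hΓ.H_eq (Ioo_subset_Icc_self hα), hH α (Ioo_subset_Icc_self hα)]
  simp [dTime, ProfileCurve.stationary]

end ProfileCurve.HasConstantSpeed

/-- Reparametrization of `[lo, hi]`, traversed backwards, such that the arc length with
density `g` grows at a constant rate. -/
theorem exists_arcLength_reparametrization {g : ℝ → ℝ} (hg : ContDiff ℝ ∞ g) {c : ℝ}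
    (hc : 0 < c) (hcg : ∀ x, c ≤ g x) {lo hi : ℝ} (hlt : lo < hi) :
    ∃ (L : ℝ) (Θ : ℝ → ℝ), 0 < L ∧ ContDiff ℝ ∞ Θ ∧ Θ 0 = hi ∧ Θ 1 = lo ∧
      ∀ α, HasDerivAt Θ (L * -(g (Θ α))⁻¹) α := by
  have hpos : ∀ x, 0 < g x := fun x => hc.trans_le (hcg x)
  set S : ℝ → ℝ := fun θ => ∫ x in hi..θ, g x
  have hSd : ∀ θ, HasDerivAt S (g θ) θ := fun θ =>
    intervalIntegral.integral_hasDerivAt_right (hg.continuous.intervalIntegrable _ _)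
      (hg.continuous.stronglyMeasurableAtFilter _ _) hg.continuous.continuousAt
  have hSmooth : ContDiff ℝ ∞ S := by
    rw [contDiff_infty_iff_deriv]
    refine ⟨fun α => (hSd α).differentiableAt, ?_⟩
    rwa [show deriv S = g from funext fun α => (hSd α).deriv]
  have hmono : StrictMono S := strictMono_of_deriv_pos fun x => by
    rw [(hSd x).deriv]; exact hpos x
  have hlin : Monotone fun x => S x - c * x := by
    refine monotone_of_deriv_nonneg
      (fun x => ((hSd x).sub ((hasDerivAt_id x).const_mul c)).differentiableAt) fun x => ?_
    rw [show (fun x => S x - c * x) = S - fun x => c * id x from rfl,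
      ((hSd x).sub ((hasDerivAt_id x).const_mul c)).deriv]
    linarith [hcg x]
  have hsurj : Function.Surjective S := by
    refine hSmooth.continuous.surjective ?_ ?_
    · refine Filter.tendsto_atTop_mono' _ ?_ (Filter.tendsto_atTop_add_const_right _ (S 0)
        (Filter.tendsto_id.const_mul_atTop hc))
      filter_upwards [Filter.eventually_ge_atTop 0] with x hx
      have := hlin hx
      simp only [id] at this ⊢
      linarith
    · refine Filter.tendsto_atBot_mono' _ ?_ (Filter.tendsto_atBot_add_const_right _ (S 0)
        (Filter.tendsto_id.const_mul_atBot hc))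
      filter_upwards [Filter.eventually_le_atBot 0] with x hx
      have := hlin hx
      simp only [id] at this ⊢
      linarith
  set e : ℝ ≃ₜ ℝ := (hmono.orderIsoOfSurjective S hsurj).toHomeomorph
  have hsymm : ContDiff ℝ ∞ e.symm :=
    e.contDiff_symm_deriv (fun x => (hpos x).ne') hSd hSmooth
  have hsymmd : ∀ y, HasDerivAt e.symm (g (e.symm y))⁻¹ y := fun y =>
    HasDerivAt.of_local_left_inverse e.symm.continuous.continuousAt (hSd _) (hpos _).ne'
      (Filter.Eventually.of_forall fun z => e.apply_symm_apply z)
  have hhi : S hi = 0 := intervalIntegral.integral_same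
  have hlo : S lo < 0 := hhi ▸ hmono hlt
  refine ⟨-S lo, fun α => e.symm (S lo * α), neg_pos.2 hlo,
    hsymm.comp (contDiff_const.mul contDiff_id), ?_, ?_, fun α => ?_⟩
  · exact e.symm_apply_eq.2 ((mul_zero _).trans hhi.symm)
  · exact e.symm_apply_eq.2 (mul_one _)
  · have := (hsymmd (S lo * α)).comp α ((hasDerivAt_id α).const_mul (S lo))
    refine this.congr_deriv ?_
    ring

/-! ### Nodaries -/

theorem ProfileCurve.IsGivenByAngle.of_strictAnti {Γ : ProfileCurve} {R Z : ℝ → ℝ}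
    (hanti : StrictAnti Γ.θ) (hcont : Continuous Γ.θ) (hr : ∀ α, Γ.r α = R (Γ.θ α))
    (hz : ∀ α, Γ.z α = Z (Γ.θ α)) : Γ.IsGivenByAngle R Z (Γ.θ 1) (Γ.θ 0) where
  strictAntiOn := hanti.strictAntiOn _
  image_eq := by
    refine Subset.antisymm ?_ (intermediate_value_Icc' zero_le_one hcont.continuousOn)
    rintro _ ⟨α, hα, rfl⟩
    exact ⟨hanti.antitone hα.2, hanti.antitone hα.1⟩
  r_eq α _ := hr α
  z_eq α _ := hz α

theorem ProfileCurve.IsGivenByAngle.mem {Γ : ProfileCurve} {R Z : ℝ → ℝ} {lo hi : ℝ}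
    (h : Γ.IsGivenByAngle R Z lo hi) {α : ℝ} (hα : α ∈ Icc (0 : ℝ) 1) : Γ.θ α ∈ Icc lo hi :=
  h.image_eq ▸ mem_image_of_mem _ hα

/-- The curve is free of self-intersections if the angle representation is. -/
theorem ProfileCurve.IsGivenByAngle.injOn {Γ : ProfileCurve} {R Z : ℝ → ℝ} {lo hi : ℝ}
    (h : Γ.IsGivenByAngle R Z lo hi) (hinj : InjOn (fun θ => (R θ, Z θ)) (Icc lo hi)) :
    InjOn (fun α => (Γ.r α, Γ.z α)) (Icc 0 1) := by
  intro x hx y hy hxy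
  simp only [h.r_eq x hx, h.z_eq x hx, h.r_eq y hy, h.z_eq y hy] at hxy
  exact h.strictAntiOn.injOn hx hy (hinj (h.mem hx) (h.mem hy) hxy)

section Nodary

variable {l a : ℝ}

theorem nodary_radicand_pos (hl : l < 0) (ha : 0 < a) (θ : ℝ) :
    0 < sin θ ^ 2 + 4 * l ^ 2 * a ^ 2 := by
  have := mul_pos (pow_pos (neg_pos.2 hl) 2) (pow_pos ha 2)
  nlinarith [sq_nonneg (sin θ)]

theorem nodary_root_pos (hl : l < 0) (ha : 0 < a) (θ : ℝ) :
    0 < √(sin θ ^ 2 + 4 * l ^ 2 * a ^ 2) :=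
  sqrt_pos.2 (nodary_radicand_pos hl ha θ)

theorem nodaryR_pos (hl : l < 0) (ha : 0 < a) (θ : ℝ) : 0 < nodaryR l a θ := by
  refine div_pos_of_neg_of_neg ?_ (by linarith)
  have := mul_pos (pow_pos (neg_pos.2 hl) 2) (pow_pos ha 2)
  rw [sub_neg]
  exact lt_sqrt_of_sq_lt (by nlinarith)

theorem nodary_root_eq (hl : l < 0) (θ : ℝ) :
    √(sin θ ^ 2 + 4 * l ^ 2 * a ^ 2) = sin θ - 2 * l * nodaryR l a θ := by
  rw [nodaryR, mul_div_cancel₀ _ (by linarith : 2 * l ≠ 0)]; ring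

/-- The first integral of the nodary. -/
theorem nodaryR_quadratic (hl : l < 0) (ha : 0 < a) (θ : ℝ) :
    l * (nodaryR l a θ ^ 2 - a ^ 2) = nodaryR l a θ * sin θ := by
  have h := sq_sqrt (nodary_radicand_pos hl ha θ).le
  rw [nodary_root_eq hl] at h
  have : 4 * l * (l * (nodaryR l a θ ^ 2 - a ^ 2) - nodaryR l a θ * sin θ) = 0 := by
    linear_combination h
  rcases mul_eq_zero.1 this with h | h <;> linarith

theorem nodaryR_lt_iff (hl : l < 0) (ha : 0 < a) {ρ : ℝ} (hρ : 0 < ρ) (θ : ℝ) :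
    nodaryR l a θ < ρ ↔ l * (ρ ^ 2 - a ^ 2) < ρ * sin θ := by
  have hr := nodaryR_pos hl ha θ
  have hq := nodaryR_quadratic hl ha θ
  set r := nodaryR l a θ
  have key : r * (ρ * sin θ - l * (ρ ^ 2 - a ^ 2)) = -l * (ρ * r + a ^ 2) * (ρ - r) := by
    linear_combination (-ρ) * hq
  have hpos : 0 < -l * (ρ * r + a ^ 2) := mul_pos (neg_pos.2 hl) (by positivity)
  rw [← sub_pos, ← mul_pos_iff_of_pos_left hpos, ← key, mul_pos_iff_of_pos_left hr, sub_pos]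

theorem nodaryR_eq (hl : l < 0) (ha : 0 < a) {ρ : ℝ} (hρ : 0 < ρ) {θ : ℝ}
    (h : l * (ρ ^ 2 - a ^ 2) = ρ * sin θ) : nodaryR l a θ = ρ := by
  have hr := nodaryR_pos hl ha θ
  have hq := nodaryR_quadratic hl ha θ
  set r := nodaryR l a θ
  have key : -l * (ρ * r + a ^ 2) * (ρ - r) = 0 := by
    linear_combination ρ * hq - r * h
  have hpos : 0 < -l * (ρ * r + a ^ 2) := mul_pos (neg_pos.2 hl) (by positivity)
  rcases mul_eq_zero.1 key with h | h <;> linarith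

theorem nodaryR_lt_nodaryR (hl : l < 0) (ha : 0 < a) {θ θ' : ℝ} (h : sin θ < sin θ') :
    nodaryR l a θ' < nodaryR l a θ := by
  rw [nodaryR_lt_iff hl ha (nodaryR_pos hl ha θ), nodaryR_quadratic hl ha]
  exact mul_lt_mul_of_pos_left h (nodaryR_pos hl ha θ)

theorem nodaryR_eq_of_sin_eq_zero (hl : l < 0) (ha : 0 < a) {θ : ℝ} (h : sin θ = 0) :
    nodaryR l a θ = a :=
  nodaryR_eq hl ha ha (by rw [h]; ring)

theorem nodaryR_le_of_sin_nonneg (hl : l < 0) (ha : 0 < a) {θ : ℝ} (h : 0 ≤ sin θ) :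
    nodaryR l a θ ≤ a := by
  rcases h.eq_or_lt with h | h
  · exact (nodaryR_eq_of_sin_eq_zero hl ha h.symm).le
  · exact ((nodaryR_lt_iff hl ha ha θ).2 (by rw [sub_self, mul_zero]; positivity)).le

theorem lt_nodaryR_of_sin_neg (hl : l < 0) (ha : 0 < a) {θ : ℝ} (h : sin θ < 0) :
    a < nodaryR l a θ := by
  have := nodaryR_lt_nodaryR hl ha (θ := θ) (θ' := 0) (by rwa [sin_zero])
  rwa [nodaryR_eq_of_sin_eq_zero hl ha sin_zero] at this

/-- The arc length element of the nodary with respect to its tangent angle. -/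
noncomputable def nodaryDensity (l a θ : ℝ) : ℝ :=
  nodaryR l a θ / √(sin θ ^ 2 + 4 * l ^ 2 * a ^ 2)

theorem nodaryDensity_pos (hl : l < 0) (ha : 0 < a) (θ : ℝ) : 0 < nodaryDensity l a θ :=
  div_pos (nodaryR_pos hl ha θ) (nodary_root_pos hl ha θ)

theorem contDiff_nodary_root (hl : l < 0) (ha : 0 < a) :
    ContDiff ℝ ∞ fun θ => √(sin θ ^ 2 + 4 * l ^ 2 * a ^ 2) :=
  ((contDiff_sin.pow 2).add contDiff_const).sqrt fun θ => (nodary_radicand_pos hl ha θ).ne'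

theorem contDiff_nodaryDensity (hl : l < 0) (ha : 0 < a) :
    ContDiff ℝ ∞ (nodaryDensity l a) :=
  ((contDiff_sin.sub (contDiff_nodary_root hl ha)).div_const _).div (contDiff_nodary_root hl ha)
    fun θ => (nodary_root_pos hl ha θ).ne'

theorem exists_le_nodaryDensity (hl : l < 0) (ha : 0 < a) :
    ∃ c > 0, ∀ θ, c ≤ nodaryDensity l a θ := by
  obtain ⟨x, -, hx⟩ := isCompact_Icc.exists_isMinOn (nonempty_Icc.2 two_pi_pos.le)
    (contDiff_nodaryDensity hl ha).continuous.continuousOn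
  refine ⟨_, nodaryDensity_pos hl ha x, fun θ => ?_⟩
  have hper : Function.Periodic (nodaryDensity l a) (2 * π) := fun θ => by
    simp only [nodaryDensity, nodaryR, sin_add_two_pi]
  obtain ⟨y, hy, hyθ⟩ := hper.exists_mem_Ico₀ two_pi_pos θ
  rw [hyθ]
  exact hx (Ico_subset_Icc_self hy)

theorem hasDerivAt_nodaryR (hl : l < 0) (ha : 0 < a) (θ : ℝ) :
    HasDerivAt (nodaryR l a) (-(nodaryDensity l a θ * cos θ)) θ := by
  have hw := nodary_root_pos hl ha θ
  have h := (((hasDerivAt_sin θ).pow 2).add_const (4 * l ^ 2 * a ^ 2)).sqrt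
    (nodary_radicand_pos hl ha θ).ne'
  have := ((hasDerivAt_sin θ).sub h).div_const (2 * l)
  refine this.congr_deriv ?_
  simp only [nodaryDensity, nodaryR, Pi.pow_apply]
  field_simp
  push_cast
  ring

theorem hasDerivAt_nodaryZ (hl : l < 0) (ha : 0 < a) (θ₀ z₀ θ : ℝ) :
    HasDerivAt (nodaryZ l a θ₀ z₀) (-(nodaryDensity l a θ * sin θ)) θ := by
  have hw := nodary_root_pos hl ha θ
  have hc : Continuous fun x => sin x ^ 2 / √(sin x ^ 2 + 4 * l ^ 2 * a ^ 2) - sin x :=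
    ((continuous_sin.pow 2).div (contDiff_nodary_root hl ha).continuous
      fun x => (nodary_root_pos hl ha x).ne').sub continuous_sin
  have h : HasDerivAt (fun θ => ∫ x in θ₀..θ,
      (sin x ^ 2 / √(sin x ^ 2 + 4 * l ^ 2 * a ^ 2) - sin x)) _ θ :=
    intervalIntegral.integral_hasDerivAt_right (hc.intervalIntegrable _ _)
      (hc.stronglyMeasurableAtFilter _ _) hc.continuousAt
  refine ((h.const_mul (-1 / (2 * l))).add_const z₀).congr_deriv ?_
  simp only [nodaryDensity, nodaryR]
  generalize √(sin θ ^ 2 + 4 * l ^ 2 * a ^ 2) = w at hw ⊢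
  have := hl.ne
  field_simp

theorem nodaryZ_self (l a θ₀ z₀ : ℝ) : nodaryZ l a θ₀ z₀ θ₀ = z₀ := by
  simp [nodaryZ]

/-- The height of the nodary above a line of inclination `φ`. -/
noncomputable def nodaryHeight (l a θ₀ z₀ φ θ : ℝ) : ℝ :=
  cos φ * nodaryZ l a θ₀ z₀ θ - sin φ * nodaryR l a θ

theorem hasDerivAt_nodaryHeight (hl : l < 0) (ha : 0 < a) (θ₀ z₀ φ θ : ℝ) :
    HasDerivAt (nodaryHeight l a θ₀ z₀ φ) (-(nodaryDensity l a θ * sin (θ - φ))) θ := by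
  refine (((hasDerivAt_nodaryZ hl ha θ₀ z₀ θ).const_mul (cos φ)).sub
    ((hasDerivAt_nodaryR hl ha θ).const_mul (sin φ))).congr_deriv ?_
  rw [sin_sub]; ring

theorem strictMonoOn_nodaryHeight (hl : l < 0) (ha : 0 < a) (θ₀ z₀ φ : ℝ) :
    StrictMonoOn (nodaryHeight l a θ₀ z₀ φ) (Icc (φ - π) φ) := by
  refine strictMonoOn_of_deriv_pos (convex_Icc _ _) (fun θ _ =>
    (hasDerivAt_nodaryHeight hl ha θ₀ z₀ φ θ).continuousAt.continuousWithinAt) fun θ hθ => ?_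
  rw [interior_Icc] at hθ
  rw [(hasDerivAt_nodaryHeight hl ha θ₀ z₀ φ θ).deriv, neg_pos]
  exact mul_neg_of_pos_of_neg (nodaryDensity_pos hl ha θ)
    (sin_neg_of_neg_of_neg_pi_lt (by linarith [hθ.2]) (by linarith [hθ.1]))

theorem strictMonoOn_nodaryZ (hl : l < 0) (ha : 0 < a) (θ₀ z₀ : ℝ) :
    StrictMonoOn (nodaryZ l a θ₀ z₀) (Icc (-π) 0) := by
  have h : nodaryHeight l a θ₀ z₀ 0 = nodaryZ l a θ₀ z₀ := by ext; simp [nodaryHeight]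
  simpa [h] using strictMonoOn_nodaryHeight hl ha θ₀ z₀ 0

theorem strictAntiOn_nodaryZ (hl : l < 0) (ha : 0 < a) (θ₀ z₀ : ℝ) :
    StrictAntiOn (nodaryZ l a θ₀ z₀) (Icc 0 π) := by
  refine strictAntiOn_of_deriv_neg (convex_Icc _ _) (fun θ _ =>
    (hasDerivAt_nodaryZ hl ha θ₀ z₀ θ).continuousAt.continuousWithinAt) fun θ hθ => ?_
  rw [interior_Icc] at hθ
  rw [(hasDerivAt_nodaryZ hl ha θ₀ z₀ θ).deriv, neg_neg_iff_pos]
  exact mul_pos (nodaryDensity_pos hl ha θ) (sin_pos_of_mem_Ioo hθ)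

/-- Half a period of a nodary on either side of its highest point has no self-intersection. -/
theorem injOn_nodary (hl : l < 0) (ha : 0 < a) (θ₀ z₀ : ℝ) :
    InjOn (fun θ => (nodaryR l a θ, nodaryZ l a θ₀ z₀ θ)) (Ioc (-π) π) := by
  have hlt : ∀ x ∈ Ioc (-π) π, ∀ y ∈ Ioc (-π) π, x < 0 → 0 ≤ y →
      nodaryR l a x ≠ nodaryR l a y := fun x hx y hy hx0 hy0 =>
    ((nodaryR_le_of_sin_nonneg hl ha (sin_nonneg_of_nonneg_of_le_pi hy0 hy.2)).trans_lt
      (lt_nodaryR_of_sin_neg hl ha (sin_neg_of_neg_of_neg_pi_lt hx0 hx.1))).ne'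
  intro x hx y hy hxy
  simp only [Prod.mk.injEq] at hxy
  rcases lt_or_ge x 0 with hx0 | hx0 <;> rcases lt_or_ge y 0 with hy0 | hy0
  · exact (strictMonoOn_nodaryZ hl ha θ₀ z₀).injOn ⟨hx.1.le, hx0.le⟩ ⟨hy.1.le, hy0.le⟩ hxy.2
  · exact absurd hxy.1 (hlt x hx y hy hx0 hy0)
  · exact absurd hxy.1.symm (hlt y hy x hx hy0 hx0)
  · exact (strictAntiOn_nodaryZ hl ha θ₀ z₀).injOn ⟨hx0, hx.2⟩ ⟨hy0, hy.2⟩ hxy.2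

/-- An arc of a nodary, traversed with constant speed and decreasing tangent angle. -/
theorem exists_nodary_arc (hl : l < 0) (ha : 0 < a) (θ₀ z₀ : ℝ) {lo hi : ℝ} (h : lo < hi) :
    ∃ (Γ : ProfileCurve) (L : ℝ) (κ : ℝ → ℝ), Γ.HasConstantSpeed L κ ∧
      Γ.IsGivenByAngle (nodaryR l a) (nodaryZ l a θ₀ z₀) lo hi ∧ Γ.θ 0 = hi ∧ Γ.θ 1 = lo ∧
      ∀ α ∈ Icc (0 : ℝ) 1, κ α + sin (Γ.θ α) / Γ.r α = 2 * l := by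
  obtain ⟨c, hc, hcg⟩ := exists_le_nodaryDensity hl ha
  obtain ⟨L, Θ, hL, hΘ, h0, h1, hd⟩ :=
    exists_arcLength_reparametrization (contDiff_nodaryDensity hl ha) hc hcg h
  have hg := nodaryDensity_pos hl ha
  refine ⟨⟨fun α => nodaryR l a (Θ α), fun α => nodaryZ l a θ₀ z₀ (Θ α), Θ⟩, L,
    fun α => -(nodaryDensity l a (Θ α))⁻¹, ⟨hL, fun α => ?_, fun α => ?_, hd, hΘ⟩, ?_, h0, h1,
    fun α _ => ?_⟩
  · refine ((hasDerivAt_nodaryR hl ha _).comp α (hd α)).congr_deriv ?_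
    have := (hg (Θ α)).ne'
    field_simp
  · refine ((hasDerivAt_nodaryZ hl ha θ₀ z₀ _).comp α (hd α)).congr_deriv ?_
    have := (hg (Θ α)).ne'
    field_simp
  · rw [← h0, ← h1]
    refine ProfileCurve.IsGivenByAngle.of_strictAnti (strictAnti_of_deriv_neg fun α => ?_)
      hΘ.continuous (fun _ => rfl) fun _ => rfl
    rw [(hd α).deriv]
    exact mul_neg_of_pos_of_neg hL (neg_neg_of_pos (inv_pos.2 (hg _)))
  · have := (nodaryR_pos hl ha (Θ α)).ne'
    simp only [nodaryDensity]
    rw [nodary_root_eq hl]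
    field_simp
    ring

end Nodary

/-! ### The catenary -/

theorem rBar_eq {A : ℝ} (hA : 0 < A) (σ : ℝ) : rBar A σ = A * √(1 + (σ / A) ^ 2) := by
  rw [rBar, ← sqrt_sq hA.le, ← sqrt_mul (sq_nonneg A), sqrt_sq hA.le]
  congr 1
  field_simp
  ring

theorem zBar_eq {A σ : ℝ} (hA : 0 < A) (hσ : 0 < σ) : zBar A σ = A * arsinh (σ / A) := by
  rw [zBar, rBar_eq hA, mul_div_cancel_left₀ _ hA.ne', ← cosh_arsinh,
    arcosh_cosh (arsinh_nonneg_iff.2 (by positivity))]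

theorem thetaBar₃_eq {A σ : ℝ} (hA : 0 < A) (hσ : 0 < σ) :
    thetaBar₃ A σ = π / 2 - arctan (σ / A) := by
  refine arcsin_eq_of_sin_eq ?_ ⟨?_, ?_⟩
  · rw [sin_pi_div_two_sub, cos_arctan, rBar_eq hA]
    have : 0 < √(1 + (σ / A) ^ 2) := by positivity
    field_simp
  · linarith [arctan_lt_pi_div_two (σ / A), pi_pos]
  · linarith [arctan_pos.2 (div_pos hσ hA)]

/-- The catenary parametrized by `σ α`, the arc length measured from its neck. -/
noncomputable def catenary (A σ : ℝ) : ProfileCurve where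
  r α := A * √(1 + (σ * α / A) ^ 2)
  z α := A * arsinh (σ * α / A)
  θ α := π / 2 - arctan (σ * α / A)

section Catenary

variable {A σ : ℝ}

theorem catenary_θ_zero : (catenary A σ).θ 0 = π / 2 := by simp [catenary]

theorem catenary_θ_one (hA : 0 < A) (hσ : 0 < σ) : (catenary A σ).θ 1 = thetaBar₃ A σ := by
  simp [catenary, thetaBar₃_eq hA hσ]

theorem sin_catenary_θ (α : ℝ) : sin ((catenary A σ).θ α) = 1 / √(1 + (σ * α / A) ^ 2) := by
  rw [catenary, sin_pi_div_two_sub, cos_arctan]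

theorem cos_catenary_θ (α : ℝ) :
    cos ((catenary A σ).θ α) = (σ * α / A) / √(1 + (σ * α / A) ^ 2) := by
  rw [catenary, cos_pi_div_two_sub, sin_arctan]

theorem hasConstantSpeed_catenary (hA : 0 < A) (hσ : 0 < σ) :
    (catenary A σ).HasConstantSpeed σ fun α => -(A * (1 + (σ * α / A) ^ 2))⁻¹ := by
  have hu : ∀ α, HasDerivAt (fun α => σ * α / A) (σ / A) α := fun α => by
    simpa using ((hasDerivAt_id α).const_mul σ).div_const A
  have hpos : ∀ α, 0 < 1 + (σ * α / A) ^ 2 := fun α => by positivity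
  refine ⟨hσ, fun α => ?_, fun α => ?_, fun α => ?_, ?_⟩
  · rw [cos_catenary_θ]
    refine (((((hu α).pow 2).const_add 1).sqrt (hpos α).ne').const_mul A).congr_deriv ?_
    have := sqrt_pos.2 (hpos α)
    simp only [Pi.pow_apply]
    generalize √(1 + (σ * α / A) ^ 2) = w at this ⊢
    norm_num
    field_simp
  · rw [sin_catenary_θ]
    refine ((hu α).arsinh.const_mul A).congr_deriv ?_
    have := sqrt_pos.2 (hpos α)
    simp only [smul_eq_mul]
    field_simp
  · refine ((hu α).arctan.const_sub (π / 2)).congr_deriv ?_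
    have := hpos α
    field_simp
  · exact contDiff_const.sub
      (contDiff_arctan.comp ((contDiff_const.mul contDiff_id).div_const A))

theorem catenary_curvature (α : ℝ) :
    -(A * (1 + (σ * α / A) ^ 2))⁻¹ + sin ((catenary A σ).θ α) / (catenary A σ).r α = 0 := by
  have hpos : 0 < 1 + (σ * α / A) ^ 2 := by positivity
  have h := sq_sqrt hpos.le
  have := sqrt_pos.2 hpos
  rw [sin_catenary_θ, catenary, div_div, mul_left_comm, ← pow_two, h, one_div, neg_add_cancel]

theorem isGivenByAngle_catenary (hA : 0 < A) (hσ : 0 < σ) :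
    (catenary A σ).IsGivenByAngle (r₃Fun A) (z₃Fun A) (thetaBar₃ A σ) (π / 2) := by
  rw [← catenary_θ_one hA hσ, ← catenary_θ_zero (A := A) (σ := σ)]
  refine ProfileCurve.IsGivenByAngle.of_strictAnti (fun x y hxy => ?_)
    (hasConstantSpeed_catenary hA hσ).contDiff_θ.continuous (fun α => ?_) fun α => ?_
  · refine sub_lt_sub_left (arctan_strictMono ?_) _
    gcongr
  · rw [r₃Fun, sin_catenary_θ, div_div_eq_mul_div, div_one]; rfl
  · have hpos : 0 < √(1 + (σ * α / A) ^ 2) := by positivity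
    rw [z₃Fun, sin_catenary_θ, cos_catenary_θ]
    change A * log (σ * α / A + √(1 + (σ * α / A) ^ 2)) = _
    congr 2
    generalize √(1 + (σ * α / A) ^ 2) = w at hpos ⊢
    field_simp
    ring

theorem strictMonoOn_catenary_r (hA : 0 < A) (hσ : 0 < σ) :
    StrictMonoOn (catenary A σ).r (Icc 0 1) := by
  intro x hx y _ hxy
  have : 0 ≤ σ * x / A := div_nonneg (mul_nonneg hσ.le hx.1) hA.le
  simp only [catenary]
  gcongr

theorem strictMono_catenary_z (hA : 0 < A) (hσ : 0 < σ) : StrictMono (catenary A σ).z := by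
  intro x y hxy
  refine mul_lt_mul_of_pos_left (arsinh_lt_arsinh.2 ?_) hA
  gcongr

theorem catenary_r_zero : (catenary A σ).r 0 = A := by simp [catenary]

theorem catenary_z_zero : (catenary A σ).z 0 = 0 := by simp [catenary]

theorem catenary_r_one (hA : 0 < A) : (catenary A σ).r 1 = rBar A σ := by
  simp [catenary, rBar_eq hA]

theorem catenary_z_one (hA : 0 < A) (hσ : 0 < σ) : (catenary A σ).z 1 = zBar A σ := by
  simp [catenary, zBar_eq hA hσ]

end Catenary

/-! ### The configuration determined by admissible parameters -/

/-- The geometric content of admissibility of the parameters `(A, σ, β)`. -/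
structure IsAdmissibleConfiguration (A σ β : ℝ) : Prop where
  A_pos : 0 < A
  σ_pos : 0 < σ
  β_mem : β ∈ Ioo (π / 2) π
  rBar_lt_one : rBar A σ < 1
  lam_neg : lam A σ β < 0
  aEll_pos : 0 < aEll A σ β
  aEll_lt : aEll A σ β < A
  thetaBar₃_mem : thetaBar₃ A σ ∈ Ioo 0 (π / 2)
  thetaBar₂_mem : thetaBar₂ A σ β ∈ Ioo 0 (π / 2)
  r₁Fun_thetaBar₁ : r₁Fun A σ β (thetaBar₁ A σ β) = rBar A σ
  r₂Fun_thetaBar₂ : r₂Fun A σ β (thetaBar₂ A σ β) = rBar A σ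
  r₁Fun_lt_one : ∀ θ ∈ Icc (thetaBar₁ A σ β) π, r₁Fun A σ β θ < 1
  z₁Fun_pi : z₁Fun A σ β π ≤ 0

theorem isAdmissibleConfiguration_of_mem {A σ β : ℝ} (hΛ : (A, σ, β) ∈ admissibleRegion) :
    IsAdmissibleConfiguration A σ β := by
  obtain ⟨A', σ', β', heq, hA, hσ, hβ, htan, hcos, hzpi, htan'⟩ := hΛ
  simp only [Prod.mk.injEq] at heq
  obtain ⟨rfl, rfl, rfl⟩ := heq
  obtain ⟨hA0, hA1⟩ := hA
  obtain ⟨hσ0, hσ1⟩ := hσ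
  have hR2 : rBar A σ ^ 2 = σ ^ 2 + A ^ 2 := sq_sqrt (by positivity)
  have hR0 : 0 < rBar A σ := sqrt_pos.2 (by positivity)
  have hσ2 : σ ^ 2 < 1 - A ^ 2 := (lt_sqrt hσ0.le).1 hσ1
  have hR1 : rBar A σ < 1 := by nlinarith
  have hc : cos β < 0 := cos_neg_of_pi_div_two_lt_of_lt hβ.1 (by linarith [hβ.2, pi_pos])
  have hs : 0 < sin β := sin_pos_of_pos_of_lt_pi (by linarith [hβ.1, pi_pos]) hβ.2
  have hT : tan β * cos β = sin β := tan_mul_cos hc.ne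
  have hN : (2 * A ^ 2 + 2 * σ ^ 2 - 1) * A * cos β + σ * sin β < 0 := by
    have : A * (1 - 2 * A ^ 2 - 2 * σ ^ 2) < σ * tan β := by
      have := mul_lt_mul_of_pos_left htan hσ0
      rwa [← mul_assoc, mul_div_cancel₀ _ hσ0.ne'] at this
    nlinarith [mul_lt_mul_of_neg_right this hc]
  have hAc : A * cos β < 0 := mul_neg_of_pos_of_neg hA0 hc
  have hD : A * cos β + σ * sin β < 0 := by nlinarith
  have hM : A ^ 2 * (A * cos β + σ * sin β) <
      (2 * A ^ 2 + 2 * σ ^ 2 - 1) * A * cos β + σ * sin β := by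
    have h1A : 0 < 1 - A ^ 2 := by nlinarith
    rw [lt_div_iff₀ (by positivity)] at htan'
    have := mul_lt_mul_of_neg_right htan' hc
    rw [show tan β * (σ * (1 - A ^ 2)) * cos β = σ * (1 - A ^ 2) * sin β by
      linear_combination σ * (1 - A ^ 2) * hT] at this
    linarith
  have h1R : 0 < 1 - A ^ 2 - σ ^ 2 := by linarith
  have hl : lam A σ β < 0 := div_neg_of_neg_of_pos hD h1R
  have hlD : lam A σ β * (1 - A ^ 2 - σ ^ 2) = A * cos β + σ * sin β :=
    div_mul_cancel₀ _ h1R.ne'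
  have hq := div_pos_of_neg_of_neg hN hD
  have ha0 : 0 < aEll A σ β := sqrt_pos.2 hq
  have ha2 : aEll A σ β ^ 2 * (A * cos β + σ * sin β) =
      (2 * A ^ 2 + 2 * σ ^ 2 - 1) * A * cos β + σ * sin β := by
    rw [aEll, sq_sqrt hq.le, div_mul_cancel₀ _ hD.ne]
  have haA : aEll A σ β < A := by
    rw [← ha2] at hM
    exact lt_of_pow_lt_pow_left₀ 2 hA0.le (lt_of_mul_lt_mul_of_nonpos_right hM hD.le)
  have hla : lam A σ β * (1 - aEll A σ β ^ 2) = 2 * A * cos β := by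
    refine mul_right_cancel₀ h1R.ne' ?_
    linear_combination (1 - aEll A σ β ^ 2) * hlD - ha2
  have h3 := thetaBar₃_eq hA0 hσ0
  have h3mem : thetaBar₃ A σ ∈ Ioo 0 (π / 2) := by
    rw [h3]
    exact ⟨by linarith [arctan_lt_pi_div_two (σ / A)],
      by linarith [arctan_pos.2 (div_pos hσ0 hA0)]⟩
  have hroot : 0 < √(1 + (σ / A) ^ 2) := by positivity
  have hsin3 : rBar A σ * sin (thetaBar₃ A σ) = A := by
    rw [h3, sin_pi_div_two_sub, cos_arctan, rBar_eq hA0]; field_simp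
  have hcos3 : rBar A σ * cos (thetaBar₃ A σ) = σ := by
    rw [h3, cos_pi_div_two_sub, sin_arctan, rBar_eq hA0]; field_simp
  have hsin1 : rBar A σ * sin (thetaBar₁ A σ β) = A * cos β - σ * sin β := by
    rw [thetaBar₁, sin_sub]
    linear_combination cos β * hsin3 - sin β * hcos3
  have hsin2 : rBar A σ * sin (thetaBar₂ A σ β) = -(A * cos β + σ * sin β) := by
    rw [thetaBar₂, show thetaBar₃ A σ - π + β = thetaBar₃ A σ + β - π by ring, sin_sub_pi,
      sin_add]
    linear_combination -cos β * hsin3 - sin β * hcos3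
  have h1 : r₁Fun A σ β (thetaBar₁ A σ β) = rBar A σ := by
    refine nodaryR_eq hl ha0 hR0 ?_
    rw [hsin1, hR2]
    linear_combination hla - hlD
  have h2 : r₂Fun A σ β (thetaBar₂ A σ β) = rBar A σ := by
    refine nodaryR_eq hl one_pos hR0 ?_
    rw [hsin2, hR2]
    linear_combination -hlD
  refine ⟨hA0, hσ0, hβ, hR1, hl, ha0, haA, h3mem, ⟨?_, ?_⟩, h1, h2, fun θ hθ => ?_, hzpi⟩
  · by_contra! h
    have := sin_nonpos_of_nonpos_of_neg_pi_le h
      (by rw [thetaBar₂]; linarith [h3mem.1, hβ.1, pi_pos])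
    nlinarith
  · rw [thetaBar₂]; linarith [h3mem.2, hβ.2]
  · rcases lt_or_ge (cos β) (-(A / √(σ ^ 2 + A ^ 2))) with h | h
    · refine (nodaryR_lt_iff hl ha0 one_pos θ).2 ?_
      rw [one_pow, hla, one_mul]
      have := hcos h
      rw [← neg_div, lt_div_iff₀ (by positivity)] at this
      linarith [neg_one_le_sin θ]
    · have hβ3 : β ≤ thetaBar₃ A σ + π / 2 := by
        refine (strictAntiOn_cos.le_iff_ge ⟨?_, ?_⟩ ⟨?_, hβ.2.le⟩).1 ?_
        · linarith [h3mem.1, pi_pos]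
        · linarith [h3mem.2]
        · linarith [hβ.1, pi_pos]
        · rw [cos_add_pi_div_two]
          refine le_trans (neg_le_neg ?_) h
          exact (div_le_iff₀ hR0).2 (by rw [mul_comm, hsin3])
      refine lt_of_le_of_lt ?_ hR1
      rw [← h1]
      have hle : sin (thetaBar₁ A σ β) ≤ sin θ := by
        have h1lo : -(π / 2) ≤ thetaBar₁ A σ β := by rw [thetaBar₁]; linarith
        rcases le_total θ (π / 2) with hθ2 | hθ2
        · exact sin_le_sin_of_le_of_le_pi_div_two h1lo hθ2 hθ.1
        · have : 0 ≤ sin θ := sin_nonneg_of_nonneg_of_le_pi (by linarith [pi_pos]) hθ.2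
          exact (sin_neg_of_neg_of_neg_pi_lt (by rw [thetaBar₁]; linarith [h3mem.2, hβ.1])
            (by linarith [pi_pos])).le.trans this
      rcases hle.eq_or_lt with hle | hle
      · exact (by rw [r₁Fun, r₁Fun, nodaryR, nodaryR, hle] : _ = _).le
      · exact (nodaryR_lt_nodaryR hl ha0 hle).le

theorem z₁Fun_thetaBar₁ (A σ β : ℝ) : z₁Fun A σ β (thetaBar₁ A σ β) = zBar A σ :=
  nodaryZ_self _ _ _ _

theorem z₂Fun_thetaBar₂ (A σ β : ℝ) : z₂Fun A σ β (thetaBar₂ A σ β) = zBar A σ :=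
  nodaryZ_self _ _ _ _

namespace IsAdmissibleConfiguration

variable {A σ β : ℝ} (h : IsAdmissibleConfiguration A σ β)

include h

theorem thetaBar₁_mem : thetaBar₁ A σ β ∈ Ioo (-π) 0 := by
  rw [thetaBar₁]
  exact ⟨by linarith [h.thetaBar₃_mem.1, h.β_mem.2], by linarith [h.thetaBar₃_mem.2, h.β_mem.1]⟩

theorem A_lt_rBar : A < rBar A σ :=
  lt_sqrt_of_sq_lt (by nlinarith [h.σ_pos])

theorem zBar_pos : 0 < zBar A σ := by
  rw [zBar_eq h.A_pos h.σ_pos]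
  exact mul_pos h.A_pos (arsinh_pos_iff.2 (div_pos h.σ_pos h.A_pos))

theorem strictAntiOn_z₁Fun : StrictAntiOn (z₁Fun A σ β) (Icc 0 π) :=
  strictAntiOn_nodaryZ h.lam_neg h.aEll_pos _ _

theorem zBar_lt_z₁Fun {θ : ℝ} (hθ : θ ∈ Ioc (thetaBar₁ A σ β) 0) :
    zBar A σ < z₁Fun A σ β θ := by
  rw [← z₁Fun_thetaBar₁ A σ β]
  exact strictMonoOn_nodaryZ h.lam_neg h.aEll_pos _ _
    ⟨h.thetaBar₁_mem.1.le, h.thetaBar₁_mem.2.le⟩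
    ⟨h.thetaBar₁_mem.1.le.trans hθ.1.le, hθ.2⟩ hθ.1

theorem existsUnique_z₁Fun_eq_zero :
    ∃! θc : ℝ, θc ∈ Ioc 0 π ∧ z₁Fun A σ β θc = 0 := by
  have h0 : 0 < z₁Fun A σ β 0 := h.zBar_pos.trans (h.zBar_lt_z₁Fun ⟨h.thetaBar₁_mem.2, le_rfl⟩)
  have hcont : ContinuousOn (z₁Fun A σ β) (Icc 0 π) := fun θ _ =>
    (hasDerivAt_nodaryZ h.lam_neg h.aEll_pos _ _ θ).continuousAt.continuousWithinAt
  obtain ⟨θc, hθc, hz⟩ := intermediate_value_Ioc' pi_pos.le hcont ⟨h.z₁Fun_pi, h0⟩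
  exact ⟨θc, ⟨hθc, hz⟩, fun θ hθ => h.strictAntiOn_z₁Fun.injOn (Ioc_subset_Icc_self hθ.1)
    (Ioc_subset_Icc_self hθc) (hθ.2.trans hz.symm)⟩

theorem strictAntiOn_r₂Fun : StrictAntiOn (r₂Fun A σ β) (Icc 0 (thetaBar₂ A σ β)) :=
  fun _ hx _ hy hxy => nodaryR_lt_nodaryR h.lam_neg one_pos
    (sin_lt_sin_of_lt_of_le_pi_div_two (by linarith [hx.1, pi_pos])
      (hy.2.trans h.thetaBar₂_mem.2.le) hxy)

theorem r₂Fun_zero : r₂Fun A σ β 0 = 1 :=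
  nodaryR_eq_of_sin_eq_zero h.lam_neg one_pos sin_zero

theorem rBar_le_r₂Fun {θ : ℝ} (hθ : θ ∈ Icc 0 (thetaBar₂ A σ β)) :
    rBar A σ ≤ r₂Fun A σ β θ := by
  rw [← h.r₂Fun_thetaBar₂]
  exact h.strictAntiOn_r₂Fun.antitoneOn hθ (right_mem_Icc.2 h.thetaBar₂_mem.1.le) hθ.2

theorem zBar_le_z₂Fun {θ : ℝ} (hθ : θ ∈ Icc 0 (thetaBar₂ A σ β)) :
    zBar A σ ≤ z₂Fun A σ β θ := by
  have hπ : thetaBar₂ A σ β ≤ π := by linarith [h.thetaBar₂_mem.2, pi_pos]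
  rw [← z₂Fun_thetaBar₂ A σ β]
  exact (strictAntiOn_nodaryZ h.lam_neg one_pos _ _).antitoneOn ⟨hθ.1, hθ.2.trans hπ⟩
    ⟨h.thetaBar₂_mem.1.le, hπ⟩ hθ.2

theorem r₁Fun_lt_A {θ : ℝ} (hθ : θ ∈ Icc 0 π) : r₁Fun A σ β θ < A :=
  (nodaryR_le_of_sin_nonneg h.lam_neg h.aEll_pos (sin_nonneg_of_mem_Icc hθ)).trans_lt h.aEll_lt

/-- The inner surface lies above, and the outer surface below, the tangent line of the outer
surface at the triple junction, as far as the tangent angle of the former is negative. -/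
theorem eq_thetaBar₁_of_meets_outer {θ₁ θ₂ : ℝ} (hθ₁ : θ₁ ∈ Icc (thetaBar₁ A σ β) π)
    (hθ₂ : θ₂ ∈ Icc 0 (thetaBar₂ A σ β)) (hr : r₁Fun A σ β θ₁ = r₂Fun A σ β θ₂)
    (hz : z₁Fun A σ β θ₁ = z₂Fun A σ β θ₂) : θ₁ = thetaBar₁ A σ β := by
  by_contra hne
  have hgt := hθ₁.1.lt_of_ne' hne
  rcases le_or_gt 0 θ₁ with h0 | h0
  · linarith [h.r₁Fun_lt_A ⟨h0, hθ₁.2⟩, h.rBar_le_r₂Fun hθ₂, h.A_lt_rBar]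
  · have h2 := h.thetaBar₂_mem
    have h12 : thetaBar₂ A σ β - π ≤ thetaBar₁ A σ β := by
      rw [thetaBar₁, thetaBar₂]; linarith [h.β_mem.2]
    have hlt := strictMonoOn_nodaryHeight h.lam_neg h.aEll_pos (thetaBar₁ A σ β) (zBar A σ)
      (thetaBar₂ A σ β) ⟨h12, by linarith [h.thetaBar₁_mem.2, h2.1]⟩
      ⟨h12.trans hθ₁.1, by linarith [h2.1]⟩ hgt
    have hle := (strictMonoOn_nodaryHeight h.lam_neg one_pos (thetaBar₂ A σ β) (zBar A σ)
      (thetaBar₂ A σ β)).monotoneOn ⟨by linarith [hθ₂.1, pi_pos], hθ₂.2⟩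
      ⟨by linarith [pi_pos], le_rfl⟩ hθ₂.2
    simp only [nodaryHeight, nodaryZ_self] at hlt hle
    have e1 := h.r₁Fun_thetaBar₁
    have e2 := h.r₂Fun_thetaBar₂
    simp only [r₁Fun, r₂Fun, z₁Fun, z₂Fun] at e1 e2 hr hz
    rw [e1, hr, hz] at hlt
    rw [e2] at hle
    exact absurd hle hlt.not_ge

end IsAdmissibleConfiguration

theorem IsAdmissibleConfiguration.exists_steadyState {A σ β : ℝ}
    (h : IsAdmissibleConfiguration A σ β) (𝒜 ℬ : ℝ) {θc : ℝ} (hθc : θc ∈ Ioc 0 π)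
    (hz : z₁Fun A σ β θc = 0) :
    ∃ Γ₁ Γ₂ Γ₃ : ProfileCurve,
      IsSteadyState 𝒜 ℬ β θc Γ₁ Γ₂ Γ₃ ∧ IsPrescribedBy A σ β θc Γ₁ Γ₂ Γ₃ := by
  have hl := h.lam_neg
  have hA := h.A_pos
  have hσ := h.σ_pos
  have hb1 := h.thetaBar₁_mem
  have hb2 := h.thetaBar₂_mem
  have hb3 := h.thetaBar₃_mem
  have i0 : (0 : ℝ) ∈ Icc (0 : ℝ) 1 := left_mem_Icc.2 zero_le_one
  have i1 : (1 : ℝ) ∈ Icc (0 : ℝ) 1 := right_mem_Icc.2 zero_le_one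
  obtain ⟨Γ₁, L₁, κ₁, s₁, g₁, a₁, b₁, k₁⟩ := exists_nodary_arc hl h.aEll_pos
    (thetaBar₁ A σ β) (zBar A σ) (hb1.2.trans hθc.1)
  obtain ⟨Γ₂, L₂, κ₂, s₂, g₂, a₂, b₂, k₂⟩ := exists_nodary_arc hl one_pos
    (thetaBar₂ A σ β) (zBar A σ) hb2.1
  have s₃ := hasConstantSpeed_catenary hA hσ
  have g₃ := isGivenByAngle_catenary hA hσ
  have k₃ : ∀ α ∈ Icc (0 : ℝ) 1, _ := fun α _ => catenary_curvature (A := A) (σ := σ) α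
  have a₃ := catenary_θ_zero (A := A) (σ := σ)
  have b₃ := catenary_θ_one hA hσ
  change Γ₁.IsGivenByAngle (r₁Fun A σ β) (z₁Fun A σ β) _ _ at g₁
  change Γ₂.IsGivenByAngle (r₂Fun A σ β) (z₂Fun A σ β) _ _ at g₂
  set Γ₃ := catenary A σ
  have r10 : Γ₁.r 0 < A := by
    rw [g₁.r_eq 0 i0, a₁]; exact h.r₁Fun_lt_A (Ioc_subset_Icc_self hθc)
  have z10 : Γ₁.z 0 = 0 := by rw [g₁.z_eq 0 i0, a₁, hz]
  have r11 : Γ₁.r 1 = rBar A σ := by rw [g₁.r_eq 1 i1, b₁, h.r₁Fun_thetaBar₁]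
  have z11 : Γ₁.z 1 = zBar A σ := by rw [g₁.z_eq 1 i1, b₁, z₁Fun_thetaBar₁]
  have r20 : Γ₂.r 0 = rBar A σ := by rw [g₂.r_eq 0 i0, a₂, h.r₂Fun_thetaBar₂]
  have z20 : Γ₂.z 0 = zBar A σ := by rw [g₂.z_eq 0 i0, a₂, z₂Fun_thetaBar₂]
  have r21 : Γ₂.r 1 = 1 := by rw [g₂.r_eq 1 i1, b₂, h.r₂Fun_zero]
  have r30 : Γ₃.r 0 = A := catenary_r_zero
  have z30 : Γ₃.z 0 = 0 := catenary_z_zero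
  have r31 : Γ₃.r 1 = rBar A σ := catenary_r_one hA
  have z31 : Γ₃.z 1 = zBar A σ := catenary_z_one hA hσ
  have m₁ : ∀ α ∈ Icc (0 : ℝ) 1, Γ₁.θ α ∈ Icc (thetaBar₁ A σ β) π := fun α hα =>
    ⟨(g₁.mem hα).1, (g₁.mem hα).2.trans hθc.2⟩
  have n₁ : Icc (thetaBar₁ A σ β) θc ⊆ Ioc (-π) π := fun θ hθ =>
    ⟨hb1.1.trans_le hθ.1, hθ.2.trans hθc.2⟩
  have n₂ : Icc 0 (thetaBar₂ A σ β) ⊆ Ioc (-π) π := fun θ hθ =>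
    ⟨by linarith [hθ.1, pi_pos], by linarith [hθ.2, hb2.2, pi_pos]⟩
  have n₃ : ∀ α ∈ Icc (0 : ℝ) 1, Γ₃.θ α ∈ Ioc (-π) π := fun α hα =>
    ⟨by linarith [(g₃.mem hα).1, hb3.1, pi_pos], by linarith [(g₃.mem hα).2, pi_pos]⟩
  have p₁ : ∀ α ∈ Icc (0 : ℝ) 1, Γ₁.r α ∈ Ioo 0 1 := fun α hα => by
    rw [g₁.r_eq α hα]
    exact ⟨nodaryR_pos hl h.aEll_pos _, h.r₁Fun_lt_one _ (m₁ α hα)⟩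
  have p₂ : ∀ α ∈ Ico (0 : ℝ) 1, Γ₂.r α ∈ Ioo 0 1 := fun α hα => by
    have hα' := Ico_subset_Icc_self hα
    rw [g₂.r_eq α hα', ← h.r₂Fun_zero]
    refine ⟨nodaryR_pos hl one_pos _,
      h.strictAntiOn_r₂Fun (left_mem_Icc.2 hb2.1.le) (g₂.mem hα') ?_⟩
    rw [← b₂]
    exact g₂.strictAntiOn hα' i1 hα.2
  have q₁ : ∀ α ∈ Ioc (0 : ℝ) 1, 0 < Γ₁.z α := fun α hα => by
    have hα' := Ioc_subset_Icc_self hα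
    rw [g₁.z_eq α hα']
    rcases lt_or_ge (Γ₁.θ α) 0 with h0 | h0
    · rcases (g₁.mem hα').1.eq_or_lt with he | hlt
      · rw [← he, z₁Fun_thetaBar₁]; exact h.zBar_pos
      · exact h.zBar_pos.trans (h.zBar_lt_z₁Fun ⟨hlt, h0.le⟩)
    · rw [← hz]
      refine h.strictAntiOn_z₁Fun ⟨h0, (m₁ α hα').2⟩ (Ioc_subset_Icc_self hθc) ?_
      rw [← a₁]
      exact g₁.strictAntiOn i0 hα' hα.1
  have q₂ : ∀ α ∈ Icc (0 : ℝ) 1, 0 < Γ₂.z α := fun α hα => by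
    rw [g₂.z_eq α hα]; exact h.zBar_pos.trans_le (h.zBar_le_z₂Fun (g₂.mem hα))
  have q₃ : ∀ α ∈ Ioc (0 : ℝ) 1, 0 < Γ₃.z α := fun α hα => by
    rw [← z30]; exact strictMono_catenary_z hA hσ hα.1
  have u₃ : ∀ α ∈ Icc (0 : ℝ) 1, Γ₃.r α ∈ Icc A (rBar A σ) := fun α hα => by
    have := (strictMonoOn_catenary_r hA hσ).monotoneOn
    exact ⟨r30 ▸ this i0 hα hα.1, r31 ▸ this hα i1 hα.2⟩
  refine ⟨Γ₁, Γ₂, Γ₃, ?_, g₁, g₂, g₃, ?_⟩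
  · exact {
      regular₁ := s₁.isRegular _ (fun α hα => n₁ (g₁.mem hα))
        (g₁.injOn ((injOn_nodary hl h.aEll_pos _ _).mono n₁))
      regular₂ := s₂.isRegular _ (fun α hα => n₂ (g₂.mem hα))
        (g₂.injOn ((injOn_nodary hl one_pos _ _).mono n₂))
      regular₃ := s₃.isRegular _ n₃ fun x _ y _ hxy =>
        (strictMono_catenary_z hA hσ).injective (congrArg Prod.snd hxy)
      motion₁ := s₁.surfaceDiffusion k₁ ℬ _
      motion₂ := s₂.surfaceDiffusion k₂ ℬ _
      motion₃ := s₃.meanCurvatureMotion k₃ 𝒜 _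
      z₁_zero := fun _ _ => z10
      z₃_zero := fun _ _ => z30
      r₂_one := fun _ _ => r21
      junction₁₂ := fun _ _ => ⟨r11.trans r20.symm, z11.trans z20.symm⟩
      junction₁₃ := fun _ _ => ⟨r11.trans r31.symm, z11.trans z31.symm⟩
      endpoints := fun _ _ => ⟨(p₁ 0 i0).1, r10.trans_eq r30.symm,
        r30.trans_lt (h.A_lt_rBar.trans h.rBar_lt_one), q₂ 1 i1,
        (hA.trans h.A_lt_rBar).trans_eq r31.symm, r31.trans_lt h.rBar_lt_one,
        h.zBar_pos.trans_eq z31.symm⟩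
      contact₁ := fun t _ => ⟨by rw [s₁.tauR_eq i0, a₁], a₁⟩
      contact₂ := fun t _ => ⟨by rw [s₂.tauZ_eq i1, b₂, sin_zero], b₂⟩
      contact₃ := fun t _ => ⟨by rw [s₃.tauR_eq i0, a₃, cos_pi_div_two], a₃⟩
      herring₁ := fun t _ => by
        have hθ : -Γ₁.θ 1 + Γ₃.θ 1 = β := by rw [b₁, b₃, thetaBar₁]; ring
        refine ⟨?_, hθ⟩
        rw [s₁.tauR_eq i1, s₁.tauZ_eq i1, s₃.tauR_eq i1, s₃.tauZ_eq i1, ← hθ, neg_add_eq_sub,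
          cos_sub]
        ring
      herring₂ := fun t _ => by
        have hθ : Γ₂.θ 0 - Γ₃.θ 1 = -π + β := by rw [a₂, b₃, thetaBar₂]; ring
        refine ⟨?_, hθ⟩
        rw [s₂.tauR_eq i0, s₂.tauZ_eq i0, s₃.tauR_eq i1, s₃.tauZ_eq i1, ← cos_sub, hθ,
          neg_add_eq_sub, cos_sub_pi, neg_neg]
      potential := fun t _ => by rw [s₁.H_eq_const t k₁ i1, s₂.H_eq_const t k₂ i0]
      flux₁ := fun t _ => s₁.dAlpha_H t k₁ i0
      flux₁₂ := fun t _ => by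
        rw [s₁.dAlpha_H t k₁ i1, s₂.dAlpha_H t k₂ i0, zero_div, zero_div]
      flux₂ := fun t _ => s₂.dAlpha_H t k₂ i1
      r₁_mem := fun α hα _ _ => p₁ α hα
      r₃_mem := fun α hα _ _ =>
        ⟨hA.trans_le (u₃ α hα).1, (u₃ α hα).2.trans_lt h.rBar_lt_one⟩
      r₂_mem := fun α hα _ _ => p₂ α hα
      z₁_pos := fun α hα _ _ => q₁ α hα
      z₃_pos := fun α hα _ _ => q₃ α hα
      z₂_pos := fun α hα _ _ => q₂ α hα
      inter₁₂ := fun t _ => by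
        refine Subset.antisymm ?_ (singleton_subset_iff.2 ⟨⟨1, i1, ?_⟩, ⟨0, i0, ?_⟩⟩)
        · rintro _ ⟨⟨x, hx, rfl⟩, ⟨y, hy, hxy⟩⟩
          obtain ⟨hr, hz⟩ : Γ₂.r y = Γ₁.r x ∧ Γ₂.z y = Γ₁.z x := Prod.mk.inj hxy
          rw [g₁.r_eq x hx, g₂.r_eq y hy] at hr
          rw [g₁.z_eq x hx, g₂.z_eq y hy] at hz
          have := h.eq_thetaBar₁_of_meets_outer (m₁ x hx) (g₂.mem hy) hr.symm hz.symm
          refine Prod.ext ((g₁.r_eq x hx).trans ?_) ((g₁.z_eq x hx).trans ?_)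
          · rw [this, h.r₁Fun_thetaBar₁]; exact r31.symm
          · rw [this, z₁Fun_thetaBar₁]; exact z31.symm
        · exact Prod.ext (r11.trans r31.symm) (z11.trans z31.symm)
        · exact Prod.ext (r20.trans r31.symm) (z20.trans z31.symm)
      inter₁₃ := fun t _ => by
        refine Subset.antisymm ?_ (singleton_subset_iff.2 ⟨⟨1, i1, ?_⟩, ⟨1, i1, rfl⟩⟩)
        · rintro _ ⟨⟨x, hx, rfl⟩, ⟨y, hy, hxy⟩⟩
          obtain ⟨hr, hz⟩ : Γ₃.r y = Γ₁.r x ∧ Γ₃.z y = Γ₁.z x := Prod.mk.inj hxy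
          have hzy : Γ₃.z y ≤ zBar A σ := z31 ▸ (strictMono_catenary_z hA hσ).monotone hy.2
          rw [g₁.r_eq x hx] at hr
          rw [g₁.z_eq x hx] at hz
          have : Γ₁.θ x = thetaBar₁ A σ β := by
            by_contra hne
            have hgt := (m₁ x hx).1.lt_of_ne' hne
            rcases le_total (Γ₁.θ x) 0 with h0 | h0
            · linarith [h.zBar_lt_z₁Fun ⟨hgt, h0⟩]
            · linarith [h.r₁Fun_lt_A ⟨h0, (m₁ x hx).2⟩, (u₃ y hy).1]
          refine Prod.ext ((g₁.r_eq x hx).trans ?_) ((g₁.z_eq x hx).trans ?_)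
          · rw [this, h.r₁Fun_thetaBar₁]; exact r31.symm
          · rw [this, z₁Fun_thetaBar₁]; exact z31.symm
        · exact Prod.ext (r11.trans r31.symm) (z11.trans z31.symm)
      inter₂₃ := fun t _ => by
        refine Subset.antisymm ?_ (singleton_subset_iff.2 ⟨⟨0, i0, ?_⟩, ⟨1, i1, rfl⟩⟩)
        · rintro _ ⟨⟨x, hx, rfl⟩, ⟨y, hy, hxy⟩⟩
          have hr : Γ₃.r y = Γ₂.r x := congrArg Prod.fst hxy
          have : y = 1 := by
            refine (strictMonoOn_catenary_r hA hσ).injOn hy i1 ((u₃ y hy).2.antisymm ?_ |>.trans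
              r31.symm)
            rw [hr, g₂.r_eq x hx]
            exact h.rBar_le_r₂Fun (g₂.mem hx)
          subst this
          exact hxy.symm
        · exact Prod.ext (r20.trans r31.symm) (z20.trans z31.symm) }
  · rw [intervalIntegral.integral_congr (g := fun _ => σ) fun α hα => s₃.speed_eq
      (by rwa [uIcc_of_le zero_le_one] at hα) 0]
    simp

theorem IsSteadyState.z₁Fun_eq_zero {𝒜 ℬ A σ β θc : ℝ} {Γ₁ Γ₂ Γ₃ : ProfileCurve}
    (h : IsSteadyState 𝒜 ℬ β θc Γ₁ Γ₂ Γ₃) (hp : IsPrescribedBy A σ β θc Γ₁ Γ₂ Γ₃) :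
    z₁Fun A σ β θc = 0 := by
  have ht : (0 : ℝ) ∈ timeInterval ⊤ := ⟨le_rfl, EReal.coe_lt_top 0⟩
  have hθ : Γ₁.θ 0 = θc := (h.contact₁ 0 ht).2
  have hz : Γ₁.z 0 = 0 := h.z₁_zero 0 ht
  rw [← hz, hp.curve₁.z_eq 0 (left_mem_Icc.2 zero_le_one), hθ]

theorem theorem4p12 (𝒜 ℬ : ℝ) (h𝒜 : 0 < 𝒜) (hℬ : 0 < ℬ) (A σ β : ℝ)
    (hΛ : (A, σ, β) ∈ admissibleRegion) :
    (∀ θc ∈ Set.Ioc 0 Real.pi, z₁Fun A σ β θc = 0 →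
      ∃ Γ₁ Γ₂ Γ₃ : ProfileCurve,
        IsSteadyState 𝒜 ℬ β θc Γ₁ Γ₂ Γ₃ ∧ IsPrescribedBy A σ β θc Γ₁ Γ₂ Γ₃) ∧
    (∃! θc : ℝ, θc ∈ Set.Ioc 0 Real.pi ∧ z₁Fun A σ β θc = 0) ∧
    (∃! θc : ℝ, θc ∈ Set.Ioc 0 Real.pi ∧
      ∃ Γ₁ Γ₂ Γ₃ : ProfileCurve,
        IsSteadyState 𝒜 ℬ β θc Γ₁ Γ₂ Γ₃ ∧ IsPrescribedBy A σ β θc Γ₁ Γ₂ Γ₃) := by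
  have h := isAdmissibleConfiguration_of_mem hΛ
  obtain ⟨θc, ⟨hθc, hz⟩, huniq⟩ := h.existsUnique_z₁Fun_eq_zero
  refine ⟨fun θ hθ hθz => h.exists_steadyState 𝒜 ℬ hθ hθz, ⟨θc, ⟨hθc, hz⟩, huniq⟩,
    θc, ⟨hθc, h.exists_steadyState 𝒜 ℬ hθc hz⟩, ?_⟩
  rintro θ ⟨hθ, Γ₁, Γ₂, Γ₃, hs, hp⟩
  exact huniq θ ⟨hθ, hs.z₁Fun_eq_zero hp⟩
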